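/- **Theorem 2 (Excess Risk).** Consider binary classification with labels $\pm1$ over a measurable space $\mathcal X$, a distribution $\mathcal D$ on $\mathcal X\times\{\pm1\}$, a teacher $g:\mathcal X\to\mathbb R$, finitely many classes $\mathcal F_1,\dots,\mathcal F_M$ ($M\ge1$) of functions $\mathcal X\to\mathbb R$, $\mathcal F=\bigcup_m\mathcal F_m$, and suppose $\|f-g\|_\infty\le G_\infty$ for all $f\in\mathcal F$, where $G_\infty>0$. Let $\operatorname{sign}(t)=+1$ for $t\ge0$ and $-1$ for $t<0$. For a sample $D=((x_i,y_i))_{i=1}^N$ and $f:\mathcal X\to\mathbb R$ put $\mathrm{err}(f)=\Pr_{(x,y)\sim\mathcal D}[\operatorname{sign}(f(x))\ne y]$ and $\widehat{\mathrm{err}}(f)=\frac1N\#\{i:\operatorname{sign}(f(x_i))\ne y_i\}$. Let $\mathcal C_T$ be the class of functions $x\mapsto\operatorname{sign}\bigl(\frac1T\sum_{t=1}^Th_t(x)\bigr)$ with $h_1,\dots,h_T\in\mathcal F$. *Algorithm.* Given $D$, $T$ and the learning rate $\eta=\frac1{G_\infty}\sqrt{\frac{\ln 2N}{T}}$, start with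 weights $K^\pm_1(i)=\frac1{2N}$ and the class $\mathcal F_1$. In round $t$ a search procedure returns some $f_t$ in the current class that is a weak learner, i.e. $$\sum_iK_t^+(i)(f_t(x_i)-g(x_i))+K_t^-(i)(g(x_i)-f_t(x_i))\ge0;$$ if it fails, one passes to the next class and searches again. Then $K^{\pm}_{t+1}(i)\propto K^\pm_t(i)\exp(\mp\eta(f_t(x_i)-g(x_i)))$, normalized so that $\sum_i(K^+_{t+1}(i)+K^-_{t+1}(i))=1$. After $T$ completed rounds the output is $F_T=\frac1T\sum_{t=1}^Tf_t$. The search procedure is arbitrary, except that $(D,x)\mapsto F_T(x)$ is jointly measurable and that completion of the $T$ rounds is a measurable event. *Claim.* For every $c>1$ there is a constant $C$ depending only on $c$ such that the following holds. Let $\epsilon>0$, $\mu\in\mathbb R$, $\delta\in(0,1)$, let $\mathcal C_T$ have VC dimension $d\ge1$, let $N\ge cd$ and $T\ge 4G_\infty^2\ln(2N)/\epsilon^2$, and let $D$ consist of $N$ i.i.d. samples from $\mathcal D$. Then with probability at least $1-\delta$ over $D$: if the algorithm completes its $T$ rounds on $D$ and $g$ has margin $\epsilon$ on $D$ except on a fraction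 less than $\mu$, that is $\frac1N\#\{i:|g(x_i)|<\epsilon\}<\mu$, then $$\mathrm{err}(F_T)\le\widehat{\mathrm{err}}(g)+C\sqrt{\frac{d\ln(N/d)+\ln(1/\delta)}{N}}+\mu .$$ -/

import Mathlib

open MeasureTheory

namespace ProgDistill

/-- A data set of `N` labelled points; the label `true` stands for `+1`, `false` for `-1`. -/
abbrev Sample (X : Type*) (N : ℕ) : Type _ := Fin N → X × Bool

/-- The sign of a real score as a binary label, with `sign 0 = +1`. -/
noncomputable def sgn (t : ℝ) : Bool := decide (0 ≤ t)

/-- Population error of the classifier `sign ∘ f`. -/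
noncomputable def err {X : Type*} [MeasurableSpace X] (P : Measure (X × Bool)) (f : X → ℝ) : ℝ :=
  P.real {z | sgn (f z.1) ≠ z.2}

/-- Empirical error of the classifier `sign ∘ f` on the sample `S`. -/
noncomputable def empErr {X : Type*} {N : ℕ} (S : Sample X N) (f : X → ℝ) : ℝ :=
  ((Finset.univ.filter fun i => sgn (f (S i).1) ≠ (S i).2).card : ℝ) / N

/-- Fraction of the sample on which `|g| < ε`. -/
noncomputable def smallMarginFraction {X : Type*} {N : ℕ} (S : Sample X N) (g : X → ℝ)
    (ε : ℝ) : ℝ :=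
  ((Finset.univ.filter fun i => |g (S i).1| < ε).card : ℝ) / N

/-! ### VC dimension -/

/-- The class `H` of binary classifiers shatters the finite set `s`: every labelling of `s` is
realized by a member of `H`. -/
def Shatters {X : Type*} (H : Set (X → Bool)) (s : Finset X) : Prop :=
  ∀ b : X → Bool, ∃ h ∈ H, ∀ x ∈ s, h x = b x

/-- The VC dimension: the supremum of the cardinalities of the shattered finite sets. -/
noncomputable def vcDim {X : Type*} (H : Set (X → Bool)) : ℕ∞ :=
  ⨆ (s : Finset X) (_ : Shatters H s), (s.card : ℕ∞)

/-- The class of signs of averages of `T` functions from `F`. -/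
def signAverages {X : Type*} (F : Set (X → ℝ)) (T : ℕ) : Set (X → Bool) :=
  {H | ∃ h : Fin T → X → ℝ, (∀ t, h t ∈ F) ∧
    H = fun x => sgn ((1 / (T : ℝ)) * ∑ t, h t x)}

/-! ### The distillation algorithm (scalar target) -/

/-- State of the main loop: the weights of the positive and negative residuals, the index of the
model class that is currently searched, and the ensemble found so far. -/
structure State (X : Type*) (N M : ℕ) where
  Kpos : Fin N → ℝ
  Kneg : Fin N → ℝ
  r : Fin M
  ensemble : List (X → ℝ)

variable {X : Type*} {N M : ℕ}

/-- Initial state: all weights `1 / (2N)`, first model class, empty ensemble. -/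
noncomputable def State.init (X : Type*) (N M : ℕ) [NeZero M] : State X N M where
  Kpos := fun _ => 1 / (2 * (N : ℝ))
  Kneg := fun _ => 1 / (2 * (N : ℝ))
  r := 0
  ensemble := []

/-- The weak learning condition of `f` with respect to `g` for the current weights. The inequality
is not strict: in the first round both weight vectors coincide, so the sum is `0` for every `f`. -/
def IsWeakLearner (g : X → ℝ) (S : Sample X N) (s : State X N M) (f : X → ℝ) : Prop :=
  0 ≤ ∑ i, (s.Kpos i * (f (S i).1 - g (S i).1) + s.Kneg i * (g (S i).1 - f (S i).1))

/-- The normalizing constant of the weight update with learning rate `η`. -/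
noncomputable def State.Z (s : State X N M) (g : X → ℝ) (η : ℝ) (S : Sample X N)
    (f : X → ℝ) : ℝ :=
  ∑ i, (s.Kpos i * Real.exp (-η * (f (S i).1 - g (S i).1)) +
    s.Kneg i * Real.exp (η * (f (S i).1 - g (S i).1)))

/-- Multiplicative update and normalization of the weights; `f` joins the ensemble. -/
noncomputable def State.update (s : State X N M) (g : X → ℝ) (η : ℝ) (S : Sample X N)
    (f : X → ℝ) : State X N M where
  Kpos := fun i => s.Kpos i * Real.exp (-η * (f (S i).1 - g (S i).1)) / s.Z g η S f
  Kneg := fun i => s.Kneg i * Real.exp (η * (f (S i).1 - g (S i).1)) / s.Z g η S f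
  r := s.r
  ensemble := f :: s.ensemble

/-- One pass through the main loop, executed while the ensemble has fewer than `T` members. The
search for a weak learner is an arbitrary procedure: it either returns some weak learner from the
current class, or fails, and then the loop moves on to the next class. -/
inductive Step (g : X → ℝ) (classes : Fin M → Set (X → ℝ)) (η : ℝ) (T : ℕ) (S : Sample X N) :
    State X N M → State X N M → Prop
  | found (s : State X N M) (f : X → ℝ) (hT : s.ensemble.length < T)
      (hf : f ∈ classes s.r) (hw : IsWeakLearner g S s f) :
      Step g classes η T S s (s.update g η S f)
  | failed (s : State X N M) (r' : Fin M) (hT : s.ensemble.length < T)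
      (hr : (r' : ℕ) = (s.r : ℕ) + 1) :
      Step g classes η T S s { s with r := r' }

/-- The average of a finite ensemble. -/
noncomputable def average (l : List (X → ℝ)) (x : X) : ℝ :=
  (1 / (l.length : ℝ)) * (l.map fun f => f x).sum

/-- `F` is a possible output of the algorithm on the sample `S` after `T` completed rounds, that
is, with an ensemble of `T` weak learners. -/
def IsOutput [NeZero M] (g : X → ℝ) (classes : Fin M → Set (X → ℝ)) (η : ℝ) (T : ℕ)
    (S : Sample X N) (F : X → ℝ) : Prop :=
  ∃ s : State X N M, Relation.ReflTransGen (Step g classes η T S) (State.init X N M) s ∧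
    s.ensemble.length = T ∧ F = average s.ensemble

end ProgDistill

/-! The bound combines a deterministic boosting estimate on the sample with a VC inequality.
Boosting: undoing the normalizations turns the weights into exponentials of minus and plus `η` times
the summed residuals (`WeightInvariant`). No weight exceeds 1, so these exponentials are at most
`2N` times the product of the normalizers, and weak learning bounds each normalizer by `cosh (η *
G)` (`State.Z_le_cosh`). For the given `η` and `T` the average is then within `ε` of `g` at every
sample point (`IsOutput.abs_sub_lt`), so the signs agree wherever `g` has margin `ε`.
Generalization: the sign of the output lies in the class of signed averages. `measure_excess_le`
compares the sample with a ghost sample, swaps paired points at random, and takes a union bound over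
the Sauer–Shelah many patterns on the `2N` points, with Hoeffding for each. Only the selected
classifier enters, never a supremum over the class, so joint measurability of the selection
suffices. -/

namespace ProgDistill

/-! ### The boosting guarantee -/

/-- The accumulated residual of an ensemble at the point `x`. -/
noncomputable def residualSum {X : Type*} (g : X → ℝ) (l : List (X → ℝ)) (x : X) : ℝ :=
  (l.map fun f => f x - g x).sum

/-- By convexity the exponential lies below its chord over `[-ηG, ηG]`. Being affine in `u`, the
bound can be averaged against the weights. -/
theorem exp_neg_mul_le_cosh_sub {η G u : ℝ} (hG : 0 < G) (hu : |u| ≤ G) :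
    Real.exp (-η * u) ≤ Real.cosh (η * G) - u / G * Real.sinh (η * G) := by
  obtain ⟨h1, h2⟩ := abs_le.1 hu
  have ha : 0 ≤ (1 + u / G) / 2 := by
    have : -1 ≤ u / G := by rw [le_div_iff₀ hG]; linarith
    linarith
  have hb : 0 ≤ (1 - u / G) / 2 := by
    have : u / G ≤ 1 := by rw [div_le_iff₀ hG]; linarith
    linarith
  have hc := convexOn_exp.2 (Set.mem_univ (-(η * G))) (Set.mem_univ (η * G)) ha hb (by ring)
  simp only [smul_eq_mul] at hc
  have e : (1 + u / G) / 2 * -(η * G) + (1 - u / G) / 2 * (η * G) = -η * u := by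
    field_simp; ring
  rw [e] at hc
  rw [Real.cosh_eq, Real.sinh_eq]
  linarith

/-- What the main loop maintains: `W` is the product of the normalizing constants. -/
structure WeightInvariant {X : Type*} {N M : ℕ} (g : X → ℝ) (F : Set (X → ℝ)) (η G : ℝ)
    (S : Sample X N) (s : State X N M) (W : ℝ) : Prop where
  mem : ∀ f ∈ s.ensemble, f ∈ F
  pos_pos : ∀ i, 0 < s.Kpos i
  neg_pos : ∀ i, 0 < s.Kneg i
  sum_eq : ∑ i, (s.Kpos i + s.Kneg i) = 1
  W_pos : 0 < W
  W_le : W ≤ 2 * N * Real.cosh (η * G) ^ s.ensemble.length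
  pos_eq : ∀ i, s.Kpos i * W = Real.exp (-η * residualSum g s.ensemble (S i).1)
  neg_eq : ∀ i, s.Kneg i * W = Real.exp (η * residualSum g s.ensemble (S i).1)

theorem weightInvariant_init {X : Type*} {N M : ℕ} [NeZero M] (hN : 0 < N) (g : X → ℝ)
    (F : Set (X → ℝ)) (η G : ℝ) (S : Sample X N) :
    WeightInvariant g F η G S (State.init X N M) (2 * N) := by
  have hN' : (0 : ℝ) < N := by exact_mod_cast hN
  constructor <;> simp [State.init, residualSum, hN, hN'.ne'] <;> field_simp <;> norm_num

/-- Averaging the chord bounds for both residual signs leaves `cosh` minus a nonnegative multiple of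
the weak learning sum. -/
theorem State.Z_le_cosh {X : Type*} {N M : ℕ} {g : X → ℝ} {η G : ℝ} (hη : 0 ≤ η) (hG : 0 < G)
    {S : Sample X N} {s : State X N M} {f : X → ℝ} (hpos : ∀ i, 0 ≤ s.Kpos i)
    (hneg : ∀ i, 0 ≤ s.Kneg i) (hsum : ∑ i, (s.Kpos i + s.Kneg i) = 1)
    (hf : ∀ x, |f x - g x| ≤ G) (hw : IsWeakLearner g S s f) :
    s.Z g η S f ≤ Real.cosh (η * G) := by
  have hsinh : 0 ≤ Real.sinh (η * G) / G :=
    div_nonneg (Real.sinh_nonneg_iff.2 (by positivity)) hG.le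
  calc s.Z g η S f
      ≤ ∑ i, ((s.Kpos i + s.Kneg i) * Real.cosh (η * G) - Real.sinh (η * G) / G *
          (s.Kpos i * (f (S i).1 - g (S i).1) + s.Kneg i * (g (S i).1 - f (S i).1))) := by
        refine Finset.sum_le_sum fun i _ => ?_
        have h1 := exp_neg_mul_le_cosh_sub (η := η) hG (hf (S i).1)
        have h2 := exp_neg_mul_le_cosh_sub (η := η) (u := -(f (S i).1 - g (S i).1)) hG
          (by rw [abs_neg]; exact hf (S i).1)
        rw [neg_mul_neg] at h2
        have h3 := mul_le_mul_of_nonneg_left h1 (hpos i)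
        have h4 := mul_le_mul_of_nonneg_left h2 (hneg i)
        refine (add_le_add h3 h4).trans_eq ?_
        ring
    _ = Real.cosh (η * G) - Real.sinh (η * G) / G *
          ∑ i, (s.Kpos i * (f (S i).1 - g (S i).1) + s.Kneg i * (g (S i).1 - f (S i).1)) := by
        rw [Finset.sum_sub_distrib, ← Finset.sum_mul, ← Finset.mul_sum, hsum, one_mul]
    _ ≤ Real.cosh (η * G) := by
        have := mul_nonneg hsinh hw
        linarith

theorem WeightInvariant.update {X : Type*} {N M : ℕ} (hN : 0 < N) {g : X → ℝ}
    {F : Set (X → ℝ)} {η G : ℝ} (hη : 0 ≤ η) (hG : 0 < G) {S : Sample X N} {s : State X N M}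
    {W : ℝ} (h : WeightInvariant g F η G S s W) {f : X → ℝ} (hfF : f ∈ F)
    (hf : ∀ x, |f x - g x| ≤ G) (hw : IsWeakLearner g S s f) :
    WeightInvariant g F η G S (s.update g η S f) (W * s.Z g η S f) := by
  have : Nonempty (Fin N) := ⟨⟨0, hN⟩⟩
  have hZ : 0 < s.Z g η S f := Finset.sum_pos (fun i _ =>
    add_pos (mul_pos (h.pos_pos i) (Real.exp_pos _)) (mul_pos (h.neg_pos i) (Real.exp_pos _)))
    Finset.univ_nonempty
  refine ⟨?_, fun i => div_pos (mul_pos (h.pos_pos i) (Real.exp_pos _)) hZ,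
    fun i => div_pos (mul_pos (h.neg_pos i) (Real.exp_pos _)) hZ, ?_, mul_pos h.W_pos hZ, ?_,
    fun i => ?_, fun i => ?_⟩
  · intro f' hf'
    rcases List.mem_cons.1 hf' with rfl | h'
    exacts [hfF, h.mem _ h']
  · simp only [State.update, ← add_div]
    rw [← Finset.sum_div]
    exact div_self hZ.ne'
  · simp only [State.update, List.length_cons, pow_succ, ← mul_assoc]
    exact mul_le_mul h.W_le (State.Z_le_cosh hη hG (fun i => (h.pos_pos i).le)
      (fun i => (h.neg_pos i).le) h.sum_eq hf hw) hZ.le (h.W_pos.le.trans h.W_le)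
  · have e : residualSum g (s.update g η S f).ensemble (S i).1 =
        (f (S i).1 - g (S i).1) + residualSum g s.ensemble (S i).1 := by
      simp [residualSum, State.update]
    rw [e, mul_add, Real.exp_add, ← h.pos_eq i]
    simp only [State.update]
    field_simp
  · have e : residualSum g (s.update g η S f).ensemble (S i).1 =
        (f (S i).1 - g (S i).1) + residualSum g s.ensemble (S i).1 := by
      simp [residualSum, State.update]
    rw [e, mul_add, Real.exp_add, ← h.neg_eq i]
    simp only [State.update]
    field_simp

theorem exists_weightInvariant {X : Type*} {N M : ℕ} [NeZero M] (hN : 0 < N) {g : X → ℝ}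
    {classes : Fin M → Set (X → ℝ)} {η G : ℝ} (hη : 0 ≤ η) (hG : 0 < G)
    (hF : ∀ f ∈ ⋃ m, classes m, ∀ x, |f x - g x| ≤ G) {T : ℕ} {S : Sample X N}
    {s : State X N M} (hs : Relation.ReflTransGen (Step g classes η T S) (State.init X N M) s) :
    ∃ W, WeightInvariant g (⋃ m, classes m) η G S s W := by
  induction hs with
  | refl => exact ⟨_, weightInvariant_init hN g _ η G S⟩
  | tail _ hstep ih =>
    obtain ⟨W, hW⟩ := ih
    cases hstep with
    | found f hT hf hw =>
      have hf' := Set.mem_iUnion_of_mem _ hf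
      exact ⟨_, hW.update hN hη hG hf' (hF f hf') hw⟩
    -- A failed search changes only the class index, which the invariant does not mention.
    | failed r' hT hr =>
      exact ⟨W, hW.mem, hW.pos_pos, hW.neg_pos, hW.sum_eq, hW.W_pos, hW.W_le, hW.pos_eq,
        hW.neg_eq⟩

/-- The positive and negative weights at `i` are each at most 1, so `W` dominates both exponentials;
having both signs yields the absolute value. -/
theorem WeightInvariant.abs_residualSum_le {X : Type*} {N M : ℕ} (hN : 0 < N) {g : X → ℝ}
    {F : Set (X → ℝ)} {η G : ℝ} (hη : 0 ≤ η) {S : Sample X N} {s : State X N M}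
    {W : ℝ} (h : WeightInvariant g F η G S s W) (i : Fin N) :
    η * |residualSum g s.ensemble (S i).1| ≤
      Real.log (2 * N) + s.ensemble.length * ((η * G) ^ 2 / 2) := by
  have hN' : (0 : ℝ) < 2 * N := by positivity
  have hW : W ≤ Real.exp (Real.log (2 * N) + s.ensemble.length * ((η * G) ^ 2 / 2)) := by
    rw [Real.exp_add, Real.exp_log hN', Real.exp_nat_mul]
    exact h.W_le.trans (mul_le_mul_of_nonneg_left
      (pow_le_pow_left₀ (Real.cosh_pos _).le (Real.cosh_le_exp_half_sq _) _) hN'.le)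
  have hK : s.Kpos i + s.Kneg i ≤ 1 := h.sum_eq ▸
    Finset.single_le_sum (f := fun i => s.Kpos i + s.Kneg i)
      (fun j _ => (add_pos (h.pos_pos j) (h.neg_pos j)).le) (Finset.mem_univ i)
  have h1 := h.pos_pos i
  have h2 := h.neg_pos i
  have h3 : Real.exp (-η * residualSum g s.ensemble (S i).1) ≤ W := by
    rw [← h.pos_eq i]
    exact mul_le_of_le_one_left h.W_pos.le (by linarith)
  have h4 : Real.exp (η * residualSum g s.ensemble (S i).1) ≤ W := by
    rw [← h.neg_eq i]
    exact mul_le_of_le_one_left h.W_pos.le (by linarith)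
  have h5 := Real.exp_le_exp.1 (h3.trans hW)
  have h6 := Real.exp_le_exp.1 (h4.trans hW)
  rw [← abs_of_nonneg hη, ← abs_mul, abs_of_nonneg hη, abs_le]
  constructor <;> linarith

theorem average_sub_eq {X : Type*} (g : X → ℝ) {l : List (X → ℝ)} (hl : l ≠ []) (x : X) :
    average l x - g x = residualSum g l x / l.length := by
  have hl' : (l.length : ℝ) ≠ 0 := by simpa using hl
  have : ∀ l : List (X → ℝ), residualSum g l x = (l.map fun f => f x).sum - l.length * g x := by
    intro l
    induction l with
    | nil => simp [residualSum]
    | cons f l ih =>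
      simp only [residualSum, List.map_cons, List.sum_cons, List.length_cons, Nat.cast_succ]
        at ih ⊢
      rw [ih]; ring
  rw [this, average]
  field_simp

/-- After `T` completed rounds the ensemble average is strictly `ε`-close to the teacher on the
sample. -/
theorem IsOutput.abs_sub_lt {X : Type*} {N M T : ℕ} [NeZero M] (hN : 0 < N) {g : X → ℝ}
    {classes : Fin M → Set (X → ℝ)} {G ε : ℝ} (hG : 0 < G) (hε : 0 < ε)
    (hF : ∀ f ∈ ⋃ m, classes m, ∀ x, |f x - g x| ≤ G)
    (hT : 4 * G ^ 2 * Real.log (2 * N) / ε ^ 2 ≤ T) {S : Sample X N} {F : X → ℝ}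
    (h : IsOutput g classes (1 / G * √(Real.log (2 * N) / T)) T S F) (i : Fin N) :
    |F (S i).1 - g (S i).1| < ε := by
  obtain ⟨s, hs, hlen, rfl⟩ := h
  have hL : 0 < Real.log (2 * N) := Real.log_pos (by
    have : (1 : ℝ) ≤ N := by exact_mod_cast hN
    linarith)
  have hT0 : (0 : ℝ) < T := lt_of_lt_of_le (by positivity) hT
  set r := √(Real.log (2 * N) / T) with hr
  have hr0 : 0 < r := Real.sqrt_pos.2 (by positivity)
  have hr2 : Real.log (2 * N) = r ^ 2 * T := by
    rw [hr, Real.sq_sqrt (by positivity)]; field_simp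
  have hGr : 2 * (G * r) ≤ ε := by
    refine le_of_sq_le_sq ?_ hε.le
    rw [div_le_iff₀ (by positivity), hr2] at hT
    refine le_of_mul_le_mul_right (a := (T : ℝ)) ?_ hT0
    linarith
  obtain ⟨W, hW⟩ := exists_weightInvariant hN (by positivity) hG hF hs
  have hb := hW.abs_residualSum_le hN (by positivity) i
  rw [average_sub_eq g (by rintro h0; simp [h0] at hlen; simp [← hlen] at hT0), abs_div,
    Nat.abs_cast, hlen, div_lt_iff₀ hT0]
  rw [hlen, hr2, show 1 / G * r * G = r by field_simp] at hb
  -- The factor `3/2` is 1 from `log (2N) = r²T` plus `1/2` from the `cosh` bound. As `2Gr ≤ ε`, the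
  -- average deviates by at most `3ε/4`.
  have h1 : r * |residualSum g s.ensemble (S i).1| ≤ r * (G * r * T * (3 / 2)) := by
    have := mul_le_mul_of_nonneg_left hb hG.le
    have e : G * (1 / G * r * |residualSum g s.ensemble (S i).1|) =
      r * |residualSum g s.ensemble (S i).1| := by field_simp
    rw [e] at this
    linarith
  have h2 := le_of_mul_le_mul_left h1 hr0
  have h3 : 0 < G * r * T := by positivity
  have h4 := mul_le_mul_of_nonneg_right hGr hT0.le
  linarith

/-! ### Consequences for the empirical error and class membership -/

/-- Strict closeness matters at `b = -ε`: since `sgn 0` is positive, `a` must be strictly negative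
there. -/
theorem sgn_eq_of_abs_sub_lt {a b ε : ℝ} (hab : |a - b| < ε) (hb : ε ≤ |b|) : sgn a = sgn b := by
  obtain ⟨h1, h2⟩ := abs_lt.1 hab
  unfold sgn
  rcases le_abs.1 hb with h | h
  · rw [decide_eq_true (by linarith), decide_eq_true (by linarith [abs_nonneg (a - b)])]
  · rw [decide_eq_false (by linarith), decide_eq_false (by linarith [abs_nonneg (a - b)])]

theorem empErr_le_add_smallMarginFraction {X : Type*} {N : ℕ} {S : Sample X N} {F g : X → ℝ}
    {ε : ℝ} (h : ∀ i, |F (S i).1 - g (S i).1| < ε) :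
    empErr S F ≤ empErr S g + smallMarginFraction S g ε := by
  rw [empErr, empErr, smallMarginFraction, ← add_div]
  refine div_le_div_of_nonneg_right ?_ N.cast_nonneg
  norm_cast
  refine le_trans (Finset.card_le_card ?_) (Finset.card_union_le _ _)
  intro i hi
  simp only [Finset.mem_union, Finset.mem_filter, Finset.mem_univ, true_and] at hi ⊢
  by_cases hm : |g (S i).1| < ε
  · exact Or.inr hm
  · exact Or.inl (sgn_eq_of_abs_sub_lt (h i) (not_lt.1 hm) ▸ hi)

theorem IsOutput.sgn_mem_signAverages {X : Type*} {N M T : ℕ} [NeZero M] (hN : 0 < N)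
    {g : X → ℝ} {classes : Fin M → Set (X → ℝ)} {η G : ℝ} (hη : 0 ≤ η) (hG : 0 < G)
    (hF : ∀ f ∈ ⋃ m, classes m, ∀ x, |f x - g x| ≤ G) {S : Sample X N} {F : X → ℝ}
    (h : IsOutput g classes η T S F) :
    (fun x => sgn (F x)) ∈ signAverages (⋃ m, classes m) T := by
  obtain ⟨s, hs, rfl, rfl⟩ := h
  obtain ⟨W, hW⟩ := exists_weightInvariant hN hη hG hF hs
  refine ⟨s.ensemble.get, fun t => hW.mem _ (List.get_mem _ _), ?_⟩
  funext x
  rw [average]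
  congr 2
  rw [← List.sum_ofFn]
  congr 1
  conv_lhs => rw [← List.ofFn_get s.ensemble, List.map_ofFn]
  rfl

/-! ### Combinatorics: counting labellings and signed sums -/

open Classical in
/-- The subsets of `ι` cut out by the class `H` along the family of points `x`. -/
noncomputable def patterns {X ι : Type*} [Fintype ι] (H : Set (X → Bool)) (x : ι → X) :
    Finset (Finset ι) :=
  Finset.univ.filter fun u => ∃ h ∈ H, ∀ i, i ∈ u ↔ h (x i) = true

theorem mem_patterns {X ι : Type*} [Fintype ι] {H : Set (X → Bool)} {x : ι → X}
    {u : Finset ι} : u ∈ patterns H x ↔ ∃ h ∈ H, ∀ i, i ∈ u ↔ h (x i) = true := by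
  simp [patterns]

open Classical in
/-- A set of indices shattered by the patterns of `H` consists of distinct points that `H`
shatters. -/
theorem card_le_of_shatters_patterns {X ι : Type*} [Fintype ι] {H : Set (X → Bool)}
    {x : ι → X} {d : ℕ} (hd : vcDim H ≤ d) {s : Finset ι}
    (hs : (patterns H x).Shatters s) : s.card ≤ d := by
  -- Indices carrying the same point belong to the same patterns, so no pattern could isolate one of
  -- them.
  have hinj : Set.InjOn x s := by
    intro i hi j hj hij
    by_contra hne
    obtain ⟨u, hu, hsu⟩ := hs.exists_inter_eq_singleton hi
    obtain ⟨h, -, hh⟩ := mem_patterns.1 hu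
    have hiu : i ∈ u := (Finset.mem_inter.1 (hsu ▸ Finset.mem_singleton_self i)).2
    have hju : j ∈ u := (hh j).2 (hij ▸ (hh i).1 hiu)
    have : j ∈ s ∩ u := Finset.mem_inter.2 ⟨hj, hju⟩
    rw [hsu, Finset.mem_singleton] at this
    exact hne this.symm
  have hsh : Shatters H (s.image x) := by
    intro b
    obtain ⟨u, hu, hsu⟩ := hs (Finset.filter_subset (fun i => b (x i) = true) s)
    obtain ⟨h, hH, hh⟩ := mem_patterns.1 hu
    refine ⟨h, hH, fun y hy => ?_⟩
    obtain ⟨i, hi, rfl⟩ := Finset.mem_image.1 hy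
    rw [Bool.eq_iff_iff, ← hh i]
    have := Finset.ext_iff.1 hsu i
    simpa [hi] using this
  rw [← Finset.card_image_of_injOn hinj]
  have : ((s.image x).card : ℕ∞) ≤ vcDim H :=
    le_iSup₂ (f := fun (s : Finset X) (_ : Shatters H s) => (s.card : ℕ∞)) _ hsh
  exact_mod_cast this.trans hd

theorem card_patterns_le_sum_choose {X ι : Type*} [Fintype ι] {H : Set (X → Bool)}
    (x : ι → X) {d : ℕ} (hd : vcDim H ≤ d) :
    (patterns H x).card ≤ ∑ k ∈ Finset.Iic d, (Fintype.card ι).choose k := by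
  classical
  refine (Finset.card_le_card_shatterer _).trans
    (Finset.card_shatterer_le_sum_vcDim.trans (Finset.sum_le_sum_of_subset ?_))
  exact Finset.Iic_subset_Iic.2 (Finset.sup_le fun s hs =>
    card_le_of_shatters_patterns hd (Finset.mem_shatterer.1 hs))

/-- For `k ≤ d`, `(d/n)^d ≤ (d/n)^k`; completing the weighted sum to the binomial expansion gives
`(1 + d/n)^n ≤ e^d`. -/
theorem sum_choose_le_exp_mul_div_pow {n d : ℕ} (hd : 1 ≤ d) (hdn : d ≤ n) :
    ((∑ k ∈ Finset.Iic d, n.choose k : ℕ) : ℝ) ≤ (Real.exp 1 * n / d) ^ d := by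
  have hd0 : (0 : ℝ) < d := by exact_mod_cast hd
  have hn0 : (0 : ℝ) < n := by exact_mod_cast hd.trans hdn
  have hq1 : (d : ℝ) / n ≤ 1 := (div_le_one hn0).2 (by exact_mod_cast hdn)
  have hq0 : 0 < (d : ℝ) / n := by positivity
  have key : (∑ k ∈ Finset.Iic d, (n.choose k : ℝ)) * ((d : ℝ) / n) ^ d ≤ Real.exp 1 ^ d := by
    calc (∑ k ∈ Finset.Iic d, (n.choose k : ℝ)) * ((d : ℝ) / n) ^ d
        ≤ ∑ k ∈ Finset.Iic d, ((d : ℝ) / n) ^ k * (n.choose k : ℝ) := by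
          rw [Finset.sum_mul]
          refine Finset.sum_le_sum fun k hk => ?_
          rw [mul_comm]
          exact mul_le_mul_of_nonneg_right
            (pow_le_pow_of_le_one hq0.le hq1 (Finset.mem_Iic.1 hk)) (Nat.cast_nonneg _)
      _ ≤ ∑ k ∈ Finset.range (n + 1), ((d : ℝ) / n) ^ k * (n.choose k : ℝ) := by
          refine Finset.sum_le_sum_of_subset_of_nonneg (fun k hk => ?_) fun _ _ _ => by positivity
          exact Finset.mem_range.2 (Nat.lt_succ_of_le ((Finset.mem_Iic.1 hk).trans hdn))
      _ = ((d : ℝ) / n + 1) ^ n := by rw [add_pow]; simp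
      _ ≤ Real.exp ((d : ℝ) / n) ^ n := by
          gcongr
          exact Real.add_one_le_exp _
      _ = Real.exp 1 ^ d := by
          rw [← Real.exp_nat_mul, ← Real.exp_nat_mul]
          congr 1
          field_simp
  push_cast
  rw [mul_div_assoc, mul_pow, ← inv_div (d : ℝ) n, inv_pow, ← div_eq_mul_inv,
    le_div_iff₀ (by positivity)]
  exact key

theorem exp_mul_add_exp_neg_mul_le {a l : ℝ} (ha : |a| ≤ 1) :
    Real.exp (l * a) + Real.exp (l * -a) ≤ 2 * Real.exp (l ^ 2 / 2) := by
  have h := Real.cosh_le_exp_half_sq (l * a)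
  have h2 : Real.exp ((l * a) ^ 2 / 2) ≤ Real.exp (l ^ 2 / 2) := by
    refine Real.exp_le_exp.2 ?_
    rw [mul_pow]
    have : a ^ 2 ≤ 1 := (sq_le_one_iff_abs_le_one a).2 ha
    have := mul_le_mul_of_nonneg_left this (sq_nonneg l)
    linarith
  rw [Real.cosh_eq] at h
  rw [mul_neg]
  linarith

/-- Hoeffding's inequality for Rademacher sums, in counting form. -/
theorem card_signed_sum_ge_le {N : ℕ} (a : Fin N → ℝ) (ha : ∀ i, |a i| ≤ 1) {t : ℝ}
    (ht : 0 ≤ t) :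
    ((Finset.univ.filter fun σ : Fin N → Bool =>
      N * t ≤ ∑ i, if σ i then -a i else a i).card : ℝ) ≤ 2 ^ N * Real.exp (-(N * t ^ 2 / 2)) := by
  have h1 : ∑ σ : Fin N → Bool, Real.exp (t * ∑ i, if σ i then -a i else a i) ≤
      2 ^ N * Real.exp (N * (t ^ 2 / 2)) := by
    have e : ∑ σ : Fin N → Bool, Real.exp (t * ∑ i, if σ i then -a i else a i) =
        ∏ i, (Real.exp (t * a i) + Real.exp (t * -a i)) := by
      have := Finset.prod_univ_sum (fun _ : Fin N => (Finset.univ : Finset Bool))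
        (fun i b => Real.exp (t * if b then -a i else a i))
      simp only [Fintype.sum_bool, Fintype.piFinset_univ] at this
      simp only [Finset.mul_sum, Real.exp_sum]
      rw [← this]
      refine Finset.prod_congr rfl fun i _ => ?_
      simp [add_comm]
    rw [e, Real.exp_nat_mul, ← mul_pow]
    refine (Finset.prod_le_prod (fun i _ => by positivity)
      fun i _ => exp_mul_add_exp_neg_mul_le (ha i)).trans_eq ?_
    simp
  -- Chernoff's bound with parameter `t`, which minimizes `N(l²/2 - lt)` over `l`.
  have h2 : ((Finset.univ.filter fun σ : Fin N → Bool =>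
      N * t ≤ ∑ i, if σ i then -a i else a i).card : ℝ) * Real.exp (t * (N * t)) ≤
      ∑ σ : Fin N → Bool, Real.exp (t * ∑ i, if σ i then -a i else a i) := by
    rw [← nsmul_eq_mul]
    refine (Finset.card_nsmul_le_sum _ _ _ fun σ hσ => ?_).trans
      (Finset.sum_le_sum_of_subset_of_nonneg (Finset.filter_subset _ _) fun _ _ _ =>
        (Real.exp_pos _).le)
    exact Real.exp_le_exp.2 (mul_le_mul_of_nonneg_left (Finset.mem_filter.1 hσ).2 ht)
  have h3 := h2.trans h1
  rw [← le_div_iff₀ (Real.exp_pos _), mul_div_assoc, ← Real.exp_sub] at h3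
  refine h3.trans_eq ?_
  congr 2
  ring

/-! ### Symmetrization -/

/-- Exchange the two points of the pairs selected by `σ`. -/
def swapAt {Z : Type*} {N : ℕ} (σ : Fin N → Bool) (w : Fin N → Z × Z) : Fin N → Z × Z :=
  fun i => if σ i then (w i).swap else w i

theorem measurePreserving_swapAt {Z : Type*} [MeasurableSpace Z] (P : Measure Z)
    [IsProbabilityMeasure P] {N : ℕ} (σ : Fin N → Bool) :
    MeasurePreserving (swapAt (Z := Z) σ) (Measure.pi fun _ => P.prod P)
      (Measure.pi fun _ => P.prod P) := by
  refine measurePreserving_pi (fun _ => P.prod P) (fun _ => P.prod P)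
    (f := fun i z => if σ i then z.swap else z) fun i => ?_
  cases σ i
  · exact MeasurePreserving.id (P.prod P)
  · simpa using Measure.measurePreserving_swap

/-- A measurable event that, for every double sample, contains at most a fraction `K` of its
coordinate swaps has probability at most `K`. -/
theorem measure_le_of_card_swapAt_le {Z : Type*} [MeasurableSpace Z] (P : Measure Z)
    [IsProbabilityMeasure P] {N : ℕ} {Q : Set (Fin N → Z × Z)} (hQ : MeasurableSet Q) {K : ℝ}
    (h : ∀ w, ∀ B : Finset (Fin N → Bool), (∀ σ ∈ B, swapAt σ w ∈ Q) →
      (B.card : ℝ) ≤ 2 ^ N * K) :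
    Measure.pi (fun _ : Fin N => P.prod P) Q ≤ ENNReal.ofReal K := by
  classical
  set ρ := Measure.pi (fun _ : Fin N => P.prod P)
  have hm : ∀ σ : Fin N → Bool, MeasurableSet (swapAt σ ⁻¹' Q) := fun σ =>
    (measurePreserving_swapAt P σ).measurable hQ
  -- All `2^N` swaps preserve `ρ`, so summing the preimages of `Q` counts, under the integral, the
  -- swaps that land in `Q`.
  have h1 : (2 : ENNReal) ^ N * ρ Q = ∫⁻ w, ∑ σ : Fin N → Bool,
      (swapAt σ ⁻¹' Q).indicator 1 w ∂ρ := by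
    rw [lintegral_finsetSum _ fun σ _ => measurable_one.indicator (hm σ)]
    rw [Finset.sum_congr rfl fun σ _ => (lintegral_indicator_one (hm σ)).trans
      ((measurePreserving_swapAt P σ).measure_preimage hQ.nullMeasurableSet)]
    simp [ρ]
  have h2 : (2 : ENNReal) ^ N * ρ Q ≤ 2 ^ N * ENNReal.ofReal K := by
    rw [h1]
    refine (lintegral_mono (g := fun _ => 2 ^ N * ENNReal.ofReal K) fun w => ?_).trans_eq
      (by simp [ρ])
    have := h w (Finset.univ.filter fun σ => swapAt σ w ∈ Q) (by simp)
    have h3 : ∑ σ : Fin N → Bool, (swapAt σ ⁻¹' Q).indicator (1 : (Fin N → Z × Z) → ENNReal) w =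
        ((Finset.univ.filter fun σ => swapAt σ w ∈ Q).card : ENNReal) := by
      simp [Set.indicator_apply]
    rw [h3, ← ENNReal.ofReal_natCast]
    refine (ENNReal.ofReal_le_ofReal this).trans_eq ?_
    rw [ENNReal.ofReal_mul (by positivity), ENNReal.ofReal_pow (by norm_num)]
    simp
  exact (ENNReal.mul_le_mul_iff_right (by simp) (by simp)).1 h2

/-- The zero-one loss. -/
noncomputable def zeroOneLoss {X : Type*} (h : X → Bool) (z : X × Bool) : ℝ :=
  if h z.1 ≠ z.2 then 1 else 0

theorem zeroOneLoss_mem_Icc {X : Type*} (h : X → Bool) (z : X × Bool) :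
    zeroOneLoss h z ∈ Set.Icc (0 : ℝ) 1 := by
  unfold zeroOneLoss
  split_ifs <;> simp

/-- The deviation event between a sample and a ghost sample has a small fraction of swaps. -/
theorem card_swapAt_deviation_le {X : Type*} {N d : ℕ} (hd : 1 ≤ d) (hdN : d ≤ N)
    {H : Set (X → Bool)} (hH : vcDim H ≤ d) (a : (Fin N → X × Bool) → X → Bool)
    {E : Set (Fin N → X × Bool)} (ha : ∀ S ∈ E, a S ∈ H) {t : ℝ} (ht : 0 ≤ t)
    (w : Fin N → (X × Bool) × (X × Bool)) (B : Finset (Fin N → Bool))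
    (hB : ∀ σ ∈ B, (fun i => (swapAt σ w i).1) ∈ E ∧
      N * t ≤ ∑ i, (zeroOneLoss (a fun i => (swapAt σ w i).1) (swapAt σ w i).2 -
        zeroOneLoss (a fun i => (swapAt σ w i).1) (swapAt σ w i).1)) :
    (B.card : ℝ) ≤ 2 ^ N *
      ((Real.exp 1 * (2 * N) / d) ^ d * Real.exp (-(N * t ^ 2 / 2))) := by
  classical
  let x : Fin N × Bool → X := fun p => if p.2 then (w p.1).2.1 else (w p.1).1.1
  let b : Finset (Fin N × Bool) → Fin N → ℝ := fun u i =>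
    (if decide ((i, true) ∈ u) ≠ (w i).2.2 then 1 else 0) -
      (if decide ((i, false) ∈ u) ≠ (w i).1.2 then 1 else 0)
  have hb : ∀ u i, |b u i| ≤ 1 := by
    intro u i
    simp only [b]
    split_ifs <;> simp
  -- The classifier varies with `σ`, but the family `x` of `2N` points does not. Once the pattern
  -- `u` is fixed, swapping a pair only flips the sign of `b u i`.
  have hsub : B ⊆ (patterns H x).biUnion fun u => Finset.univ.filter fun σ : Fin N → Bool =>
      N * t ≤ ∑ i, if σ i then -b u i else b u i := by
    intro σ hσ
    obtain ⟨hE, hs⟩ := hB σ hσ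
    set h := a fun i => (swapAt σ w i).1
    refine Finset.mem_biUnion.2 ⟨Finset.univ.filter fun p => h (x p) = true,
      mem_patterns.2 ⟨h, ha _ hE, by simp⟩, Finset.mem_filter.2 ⟨Finset.mem_univ _, ?_⟩⟩
    refine hs.trans_eq (Finset.sum_congr rfl fun i _ => ?_)
    cases hσi : σ i <;> simp [swapAt, hσi, b, x, zeroOneLoss]
  have hcard : ((patterns H x).card : ℝ) ≤ (Real.exp 1 * (2 * N) / d) ^ d := by
    have h1 := card_patterns_le_sum_choose x hH
    have h2 := sum_choose_le_exp_mul_div_pow (n := Fintype.card (Fin N × Bool)) hd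
      (by simp; omega)
    refine (Nat.cast_le.2 h1).trans (h2.trans_eq ?_)
    simp [mul_comm]
  calc (B.card : ℝ) ≤ ∑ u ∈ patterns H x, ((Finset.univ.filter fun σ : Fin N → Bool =>
        N * t ≤ ∑ i, if σ i then -b u i else b u i).card : ℝ) := by
        exact_mod_cast (Finset.card_le_card hsub).trans Finset.card_biUnion_le
    _ ≤ ∑ u ∈ patterns H x, 2 ^ N * Real.exp (-(N * t ^ 2 / 2)) :=
        Finset.sum_le_sum fun u _ => card_signed_sum_ge_le (b u) (hb u) ht
    _ = 2 ^ N * ((patterns H x).card * Real.exp (-(N * t ^ 2 / 2))) := by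
        rw [Finset.sum_const, nsmul_eq_mul]; ring
    _ ≤ _ := by gcongr

/-- With probability at least one half, a ghost sample has empirical error close to the population
error. -/
theorem half_le_measure_ghost {X : Type*} [MeasurableSpace X] (P : Measure (X × Bool))
    [IsProbabilityMeasure P] {N : ℕ} {h : X → Bool} (hh : MeasurableSet {z : X × Bool | h z.1 ≠ z.2})
    {t : ℝ} (ht : 0 ≤ t) (hNt : 2 ≤ N * t ^ 2) :
    1 / 2 ≤ Measure.pi (fun _ : Fin N => P)
      {S | N * (P.real {z | h z.1 ≠ z.2} - t / 2) < ∑ i, zeroOneLoss h (S i)} := by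
  set p := P.real {z | h z.1 ≠ z.2} with hp
  have hmeas : Measurable (zeroOneLoss h) := Measurable.ite hh measurable_const measurable_const
  -- The loss is negated to get its lower tail from an upper-tail Hoeffding bound.
  have hint : ∫ z, -zeroOneLoss h z ∂P = -p := by
    rw [integral_neg, hp, ← integral_indicator_one hh]
    congr 2
    funext z
    simp [zeroOneLoss, Set.indicator_apply]
  have hN : (0 : ℝ) < N := by
    rcases Nat.eq_zero_or_pos N with rfl | h0
    · norm_num at hNt
    · exact_mod_cast h0
  have hsg : ∀ i ∈ (Finset.univ : Finset (Fin N)), ProbabilityTheory.HasSubgaussianMGF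
      (fun S : Fin N → X × Bool => -zeroOneLoss h (S i) - -p) (1 / 4)
        (Measure.pi fun _ : Fin N => P) := by
    intro i _
    have h0 := ProbabilityTheory.hasSubgaussianMGF_of_mem_Icc (μ := P)
      (X := fun z => -zeroOneLoss h z) (a := -1) (b := 0) hmeas.neg.aemeasurable
      (Filter.Eventually.of_forall fun z => by
        have := zeroOneLoss_mem_Icc h z
        constructor <;> linarith [this.1, this.2])
    rw [hint] at h0
    have e : (‖(0 : ℝ) - -1‖₊ / 2) ^ 2 = 1 / 4 := by
      ext; norm_num
    rw [e] at h0
    refine ProbabilityTheory.HasSubgaussianMGF.of_map (Y := fun S : Fin N → X × Bool => S i)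
      (measurable_pi_apply i).aemeasurable
      (X := fun z => -zeroOneLoss h z - -p) ?_
    rwa [(measurePreserving_eval (fun _ : Fin N => P) i).map_eq]
  have hind : ProbabilityTheory.iIndepFun
      (fun (i : Fin N) (S : Fin N → X × Bool) => -zeroOneLoss h (S i) - -p)
      (Measure.pi fun _ : Fin N => P) :=
    ProbabilityTheory.iIndepFun_pi (X := fun _ z => -zeroOneLoss h z - -p)
      fun i => (hmeas.neg.sub_const _).aemeasurable
  have hoeff := ProbabilityTheory.HasSubgaussianMGF.measure_sum_ge_le_of_iIndepFun hind hsg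
    (ε := N * (t / 2)) (by positivity)
  have hexp : Real.exp (-(N * (t / 2)) ^ 2 / (2 * ∑ i : Fin N, ((1 / 4 : NNReal) : ℝ))) ≤ 1 / 2 := by
    have e : -(N * (t / 2)) ^ 2 / (2 * ∑ i : Fin N, ((1 / 4 : NNReal) : ℝ)) = -(N * t ^ 2 / 2) := by
      simp
      field_simp
      norm_num
    rw [e, Real.exp_neg, one_div]
    refine inv_anti₀ two_pos ?_
    have := Real.add_one_le_exp (N * t ^ 2 / 2)
    linarith
  have hms : MeasurableSet {S : Fin N → X × Bool |
      N * (t / 2) ≤ ∑ i, (-zeroOneLoss h (S i) - -p)} :=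
    measurableSet_le measurable_const (Finset.measurable_sum _ fun i _ =>
      ((hmeas.comp (measurable_pi_apply i)).neg.sub_const _))
  have hcompl := probReal_compl_eq_one_sub (μ := Measure.pi fun _ : Fin N => P) hms
  have hset : {S : Fin N → X × Bool | N * (p - t / 2) < ∑ i, zeroOneLoss h (S i)} =
      {S : Fin N → X × Bool | N * (t / 2) ≤ ∑ i, (-zeroOneLoss h (S i) - -p)}ᶜ := by
    ext S
    simp only [Set.mem_ofPred_eq, Set.mem_compl_iff, not_le, Finset.sum_sub_distrib,
      Finset.sum_neg_distrib, Finset.sum_const, Finset.card_univ, Fintype.card_fin, nsmul_eq_mul]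
    constructor <;> intro h <;> linarith
  rw [hset, ← ofReal_measureReal, hcompl, ← ENNReal.ofReal_one,
    ← ENNReal.ofReal_ofNat 2, ← ENNReal.ofReal_div_of_pos two_pos]
  exact ENNReal.ofReal_le_ofReal (by push_cast at hoeff hexp ⊢; linarith)

theorem measurable_zeroOneLoss_uncurry {X Ω : Type*} [MeasurableSpace X] [MeasurableSpace Ω]
    {a : Ω → X → Bool} (ha : Measurable (Function.uncurry a)) :
    Measurable fun q : Ω × (X × Bool) => zeroOneLoss (a q.1) q.2 := by
  have h : Measurable fun q : Ω × (X × Bool) => a q.1 q.2.1 :=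
    ha.comp (measurable_fst.prodMk measurable_snd.fst)
  exact Measurable.ite (measurableSet_eq_fun h measurable_snd.snd).compl measurable_const
    measurable_const

/-- The Vapnik–Chervonenkis inequality for a measurably selected classifier: the class itself
carries no measurability assumption. -/
theorem measure_excess_le {X : Type*} [MeasurableSpace X] (P : Measure (X × Bool))
    [IsProbabilityMeasure P] {N d : ℕ} (hd : 1 ≤ d) (hdN : d ≤ N) {H : Set (X → Bool)}
    (hH : vcDim H ≤ d) {a : (Fin N → X × Bool) → X → Bool}
    (ha : Measurable (Function.uncurry a)) {E : Set (Fin N → X × Bool)} (hE : MeasurableSet E)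
    (haE : ∀ S ∈ E, a S ∈ H) {t : ℝ} (ht : 0 ≤ t) (hNt : 2 ≤ N * t ^ 2) :
    Measure.pi (fun _ : Fin N => P)
      {S | S ∈ E ∧ ∑ i, zeroOneLoss (a S) (S i) + N * t ≤ N * P.real {z | a S z.1 ≠ z.2}} ≤
      ENNReal.ofReal (2 * ((Real.exp 1 * (2 * N) / d) ^ d * Real.exp (-(N * t ^ 2 / 8)))) := by
  set π := Measure.pi fun _ : Fin N => P
  have hloss := measurable_zeroOneLoss_uncurry ha
  have hempS : ∀ i, Measurable fun q : (Fin N → X × Bool) × (Fin N → X × Bool) =>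
      zeroOneLoss (a q.1) (q.2 i) := fun i =>
    hloss.comp (measurable_fst.prodMk ((measurable_pi_apply i).comp measurable_snd))
  have hemp1 : ∀ i, Measurable fun q : (Fin N → X × Bool) × (Fin N → X × Bool) =>
      zeroOneLoss (a q.1) (q.1 i) := fun i =>
    hloss.comp (measurable_fst.prodMk ((measurable_pi_apply i).comp measurable_fst))
  have herrset : MeasurableSet {q : (Fin N → X × Bool) × (X × Bool) | a q.1 q.2.1 ≠ q.2.2} :=
    (measurableSet_eq_fun (ha.comp (measurable_fst.prodMk measurable_snd.fst))
      measurable_snd.snd).compl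
  have herr : Measurable fun S => P.real {z | a S z.1 ≠ z.2} :=
    (measurable_measure_prodMk_left herrset).ennreal_toReal
  set B := {S | S ∈ E ∧ ∑ i, zeroOneLoss (a S) (S i) + N * t ≤ N * P.real {z | a S z.1 ≠ z.2}}
  have hBm : MeasurableSet B := by
    refine hE.inter (measurableSet_le (Measurable.add_const ?_ _) (herr.const_mul _))
    exact Finset.measurable_sum _ fun i _ =>
      (hemp1 i).comp (measurable_id.prodMk measurable_id)
  -- Half of the gap `t` is left for the fluctuation of the ghost sample; Hoeffding at `t / 2`
  -- produces the exponent `N * t ^ 2 / 8`.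
  set Q : Set ((Fin N → X × Bool) × (Fin N → X × Bool)) := {q | q.1 ∈ E ∧
    N * (t / 2) ≤ ∑ i, (zeroOneLoss (a q.1) (q.2 i) - zeroOneLoss (a q.1) (q.1 i))}
  have hQm : MeasurableSet Q := by
    have hsum : Measurable fun q : (Fin N → X × Bool) × (Fin N → X × Bool) =>
        ∑ i, (zeroOneLoss (a q.1) (q.2 i) - zeroOneLoss (a q.1) (q.1 i)) :=
      Finset.measurable_sum _ fun i _ => (hempS i).sub (hemp1 i)
    exact (measurable_fst hE).inter (measurableSet_le measurable_const hsum)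
  have hQle : (π.prod π) Q ≤ ENNReal.ofReal
      ((Real.exp 1 * (2 * N) / d) ^ d * Real.exp (-(N * t ^ 2 / 8))) := by
    have hmp := measurePreserving_arrowProdEquivProdArrow (X × Bool) (X × Bool) (Fin N)
      (fun _ => P) (fun _ => P)
    rw [← hmp.measure_preimage hQm.nullMeasurableSet]
    refine measure_le_of_card_swapAt_le P (hmp.measurable hQm) fun w B' hB' => ?_
    have := card_swapAt_deviation_le hd hdN hH a haE (t := t / 2) (by positivity) w B'
      fun σ hσ => hB' σ hσ
    rwa [show (N : ℝ) * (t / 2) ^ 2 / 2 = N * t ^ 2 / 8 by ring] at this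
  -- Fubini: for each `S ∈ B` the slice of `Q` contains the ghost event, of mass at least one half.
  have hhalf : 1 / 2 * π B ≤ (π.prod π) Q := by
    rw [Measure.prod_apply hQm, ← setLIntegral_const]
    refine (setLIntegral_mono_ae' hBm (Filter.Eventually.of_forall fun S hS => ?_)).trans
      (setLIntegral_le_lintegral _ _)
    have hsec : MeasurableSet {z : X × Bool | a S z.1 ≠ z.2} := measurable_prodMk_left herrset
    refine (half_le_measure_ghost P hsec ht hNt).trans (measure_mono fun S' hS' => ?_)
    refine ⟨hS.1, ?_⟩
    have h1 := hS.2
    rw [Set.mem_ofPred_eq] at hS'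
    rw [Finset.sum_sub_distrib]
    linarith
  have h2 : π B = 2 * (1 / 2 * π B) := by
    rw [← mul_assoc, one_div, ENNReal.mul_inv_cancel (by simp) (by simp), one_mul]
  rw [h2, ENNReal.ofReal_mul (by norm_num)]
  exact mul_le_mul' (by simp) (hhalf.trans hQle)

/-! ### Choice of the constant and assembly -/

theorem empErr_eq_sum {X : Type*} {N : ℕ} (S : Sample X N) (f : X → ℝ) :
    empErr S f = (∑ i, zeroOneLoss (fun x => sgn (f x)) (S i)) / N := by
  simp only [empErr, zeroOneLoss, Finset.sum_boole]

theorem measurable_sgn : Measurable sgn :=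
  measurable_to_bool (by
    convert measurableSet_Ici (a := (0 : ℝ)) using 1
    ext t
    simp [sgn])

/-- The growth function and the confidence term are absorbed by the deviation bound. -/
theorem two_mul_growth_mul_exp_le {c : ℝ} (hc : 1 < c) {N d : ℕ} (hd : 1 ≤ d)
    (hN : c * d ≤ N) {δ : ℝ} (hδ : 0 < δ) (hδ1 : δ < 1) :
    2 * ((Real.exp 1 * (2 * N) / d) ^ d * Real.exp
      (-((1 + 3 / Real.log c) * (d * Real.log (N / d) + Real.log (1 / δ))))) ≤ δ := by
  have hd1 : (1 : ℝ) ≤ d := by exact_mod_cast hd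
  have hd0 : (0 : ℝ) < d := by linarith
  have hlc : 0 < Real.log c := Real.log_pos hc
  have hcN : c ≤ N / d := (le_div_iff₀ hd0).2 hN
  have hq : 0 < (N : ℝ) / d := by linarith
  set L := Real.log (N / d) with hL
  have hLc : Real.log c ≤ L := Real.log_le_log (by linarith) hcN
  have hδL : 0 ≤ Real.log (1 / δ) := Real.log_nonneg (one_le_one_div hδ hδ1.le)
  have h2 : Real.log 2 ≤ 1 := by linarith [Real.log_two_lt_d9]
  have h2' : Real.log 2 * 2 ≤ 2 := by linarith
  have e1 : Real.exp 1 * (2 * N) / d = Real.exp (1 + Real.log 2 + L) := by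
    rw [Real.exp_add, Real.exp_add, Real.exp_log two_pos, hL, Real.exp_log hq]
    ring
  have e2 : (2 : ℝ) = Real.exp (Real.log 2) := (Real.exp_log two_pos).symm
  have e3 : δ = Real.exp (-Real.log (1 / δ)) := by
    rw [one_div, Real.log_inv, neg_neg, Real.exp_log hδ]
  rw [e1, ← Real.exp_nat_mul]
  nth_rewrite 1 [e2]
  nth_rewrite 2 [e3]
  rw [← Real.exp_add, ← Real.exp_add]
  refine Real.exp_le_exp.2 ?_
  -- Three units per `d` absorb the leading 2 and the factor `(2e)^d`, since `log 2 + d + d * log 2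
  -- ≤ 3 * d`.
  have h3 : 3 ≤ 3 / Real.log c * L := by
    rw [div_mul_eq_mul_div, le_div_iff₀ hlc]
    linarith
  have h4 : (d : ℝ) * 3 ≤ d * (3 / Real.log c * L) := mul_le_mul_of_nonneg_left h3 hd0.le
  have h5 : 0 ≤ 3 / Real.log c * Real.log (1 / δ) := by positivity
  have h6 : (d : ℝ) * Real.log 2 ≤ d * 1 := mul_le_mul_of_nonneg_left h2 hd0.le
  nlinarith

end ProgDistill

theorem theorem2 (c : ℝ) (hc : 1 < c) :
    ∃ C : ℝ, 0 < C ∧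
      ∀ (X : Type*) [MeasurableSpace X]
        -- the distribution of the labelled examples, the teacher, and the model classes
        (P : Measure (X × Bool)) [IsProbabilityMeasure P]
        (g : X → ℝ) (M : ℕ) [NeZero M] (classes : Fin M → Set (X → ℝ))
        (G : ℝ) (_ : 0 < G) (_ : ∀ f ∈ ⋃ m, classes m, ∀ x, |f x - g x| ≤ G)
        (ε : ℝ) (_ : 0 < ε) (μ : ℝ) (δ : ℝ) (_ : 0 < δ) (_ : δ < 1)
        -- sample size, number of rounds, VC dimension
        (N T d : ℕ) (_ : 1 ≤ d) (_ : c * d ≤ N)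
        (_ : ProgDistill.vcDim (ProgDistill.signAverages (⋃ m, classes m) T) = (d : ℕ∞))
        (_ : 4 * G ^ 2 * Real.log (2 * N) / ε ^ 2 ≤ T)
        -- the trained predictor as a function of the sample; `E` is the event that all `T` rounds
        -- are completed
        (A : ProgDistill.Sample X N → X → ℝ) (_ : Measurable (Function.uncurry A))
        (E : Set (ProgDistill.Sample X N)) (_ : MeasurableSet E)
        (_ : ∀ S ∈ E, ProgDistill.IsOutput g classes
          (1 / G * √(Real.log (2 * N) / T)) T S (A S)),
        -- except with probability at most `δ`: if the run is completed and `g` has `ε` margin on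
        -- the sample outside a fraction less than `μ`, then the bound holds
        Measure.pi (fun _ : Fin N => P)
          {S | ¬ (S ∈ E → ProgDistill.smallMarginFraction S g ε < μ →
            ProgDistill.err P (A S) ≤ ProgDistill.empErr S g
              + C * √((d * Real.log (N / d) + Real.log (1 / δ)) / N) + μ)}
          ≤ ENNReal.ofReal δ := by
  have hlc : 0 < Real.log c := Real.log_pos hc
  -- Chosen so that the exponent `N * t ^ 2 / 8` becomes `(1 + 3 / log c) * R`.
  refine ⟨√(8 * (1 + 3 / Real.log c)), by positivity, ?_⟩
  intro X _ P _ g M _ classes G hG hF ε hε μ δ hδ hδ1 N T d hd hN hvc hT A hA E hE hout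
  have hd1 : (1 : ℝ) ≤ d := by exact_mod_cast hd
  have hd0 : (0 : ℝ) < d := by linarith
  have hdN' : (d : ℝ) ≤ N := (le_mul_of_one_le_left hd0.le hc.le).trans hN
  have hdN : d ≤ N := by exact_mod_cast hdN'
  have hN0 : (0 : ℝ) < N := hd0.trans_le hdN'
  have hNpos : 0 < N := by exact_mod_cast hN0
  have hLc : Real.log c ≤ Real.log (N / d) :=
    Real.log_le_log (by linarith) ((le_div_iff₀ hd0).2 hN)
  have hδL : 0 ≤ Real.log (1 / δ) := Real.log_nonneg (one_le_one_div hδ hδ1.le)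
  set R := d * Real.log (N / d) + Real.log (1 / δ) with hR
  have hRc : Real.log c ≤ R := by
    have : Real.log (N / d) ≤ d * Real.log (N / d) :=
      le_mul_of_one_le_left (hlc.le.trans hLc) hd1
    linarith
  have hR0 : 0 < R := hlc.trans_le hRc
  set t := √(8 * (1 + 3 / Real.log c)) * √(R / N) with ht
  have ht0 : 0 ≤ t := by positivity
  have hNt : N * t ^ 2 = 8 * ((1 + 3 / Real.log c) * R) := by
    rw [ht, mul_pow, Real.sq_sqrt (by positivity), Real.sq_sqrt (by positivity)]
    field_simp
  have hNt2 : 2 ≤ N * t ^ 2 := by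
    have h3 : 3 ≤ 3 / Real.log c * R := by
      rw [div_mul_eq_mul_div, le_div_iff₀ hlc]
      linarith
    rw [hNt]
    linarith
  have hmain := ProgDistill.measure_excess_le P hd hdN hvc.le
    (a := fun S x => ProgDistill.sgn (A S x)) (ProgDistill.measurable_sgn.comp hA) hE
    (fun S hS => (hout S hS).sgn_mem_signAverages hNpos (by positivity) hG hF) ht0 hNt2
  rw [show (N : ℝ) * t ^ 2 / 8 = (1 + 3 / Real.log c) * R by rw [hNt]; ring] at hmain
  refine (measure_mono fun S hS => ?_).trans
    (hmain.trans (ENNReal.ofReal_le_ofReal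
      (ProgDistill.two_mul_growth_mul_exp_le hc hd hN hδ hδ1)))
  simp only [Set.mem_ofPred_eq, Classical.not_imp, not_le] at hS
  obtain ⟨hSE, hm, hlt⟩ := hS
  refine ⟨hSE, ?_⟩
  have h1 := ProgDistill.empErr_le_add_smallMarginFraction
    fun i => (hout S hSE).abs_sub_lt hNpos hG hε hF hT i
  have h2 : ProgDistill.empErr S (A S) + t ≤ ProgDistill.err P (A S) := by linarith
  rw [ProgDistill.empErr_eq_sum] at h2
  have h3 := mul_le_mul_of_nonneg_left h2 hN0.le
  rwa [mul_add, mul_div_cancel₀ _ hN0.ne'] at h3
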